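/- Let $f:2^{[n]}\to\mathbb{Z}_{\ge 0}$, $[n]=\{1,\dots,n\}$, satisfy $f(\emptyset)=0$, $f(I)\le f(J)$ for $I\subseteq J$, and $f(I\cup J)+f(I\cap J)\le f(I)+f(J)$ for all $I,J\subseteq[n]$, and let $$P=\Big\{a\in\mathbb{Z}_{\ge 0}^n : \sum_{i\in I}a_i\le f(I)\text{ for all } I\subseteq[n],\ \sum_{i\in[n]}a_i=f([n])\Big\}$$ be the polymatroid with rank function $f$. Let $e_1,\dots,e_n$ be the standard basis vectors. For $a\in P$ let $\mathrm{Int}(a)$ be the set of all $i\in[n]$ such that $a-e_i+e_j\notin P$ for every $j<i$, and let $\mathrm{Ext}(a)$ be the set of all $i\in[n]$ such that $a+e_i-e_j\notin P$ for every $j<i$. Define the interior and the exterior polynomial of $P$ by $$I_P(x)=\sum_{a\in P}x^{\,n-|\mathrm{Int}(a)|},\qquad X_P(y)=\sum_{a\in P}y^{\,n-|\mathrm{Ext}(a)|},$$ and put $$r_2(P)=\min\{n-|F| : F\subseteq[n],\ f(F)\le f([n])-2\},\qquad r_2'(P)=\min\Big\{|F| : F\subseteq[n],\ \sum_{i\in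 F}f(\{i\})-f(F)\ge 2\Big\},$$ where the minimum of the empty set is $+\infty$. Write $[z^i]p$ for the coefficient of $z^i$ in a polynomial $p$. A finite or infinite sequence $a_0,a_1,\dots$ is unimodal if there is an integer $k\ge 0$ such that $a_i\le a_{i+1}$ whenever $i<k$ and $a_i\ge a_{i+1}$ whenever $i\ge k$ (for all $i$ such that $a_i$ and $a_{i+1}$ are terms of the sequence). Then: (i) the sequence $[y^0]X_P,\ [y^1]X_P,\ \dots,\ [y^{r_2(P)-1}]X_P$ is unimodal (if $r_2(P)=+\infty$: the sequence of all coefficients $[y^i]X_P$, $i\ge 0$, is unimodal); (ii) the sequence $[x^0]I_P,\ [x^1]I_P,\ \dots,\ [x^{r_2'(P)-1}]I_P$ is unimodal (if $r_2'(P)=+\infty$: the sequence of all coefficients $[x^i]I_P$, $i\ge 0$, is unimodal). -/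

import Mathlib

/-- An integer polymatroid over the ground set `[n]` (modelled by `Fin n` with its usual order),
given by its rank function: a normalized, monotone, submodular function on the subsets of `[n]`
with values in the non-negative integers. The set of its lattice points is
`Polymatroid.bases`. -/
structure Polymatroid (n : ℕ) where
  /-- the rank function -/
  rank : Finset (Fin n) → ℕ
  rank_empty : rank ∅ = 0
  rank_mono : ∀ I J : Finset (Fin n), I ⊆ J → rank I ≤ rank J
  rank_submodular : ∀ I J : Finset (Fin n), rank (I ∪ J) + rank (I ∩ J) ≤ rank I + rank J

namespace Polymatroid

variable {n : ℕ} (P : Polymatroid n)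

/-- The set of bases: all `a ∈ ℤⁿ` with `a ≥ 0`, `∑_{i ∈ I} aᵢ ≤ f(I)` for every `I ⊆ [n]`, and
`∑_{i ∈ [n]} aᵢ = f([n])`. -/
def bases : Set (Fin n → ℤ) :=
  {a | (∀ i, 0 ≤ a i) ∧ (∀ I : Finset (Fin n), ∑ i ∈ I, a i ≤ (P.rank I : ℤ)) ∧
    ∑ i, a i = (P.rank Finset.univ : ℤ)}

theorem bases_finite : P.bases.Finite := by
  refine (Set.finite_Icc (0 : Fin n → ℤ) (fun i => (P.rank {i} : ℤ))).subset ?_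
  rintro a ⟨h0, h1, -⟩
  exact ⟨fun i => h0 i, fun i => by simpa using h1 {i}⟩

/-- The standard basis vector `eᵢ` of `ℤⁿ`. -/
def stdVec (i : Fin n) : Fin n → ℤ := Pi.single i 1

open Classical in
/-- The set of internally active indices of `a`: those `i` such that `a - eᵢ + eⱼ ∉ P` for all
`j < i`. -/
noncomputable def internallyActive (a : Fin n → ℤ) : Finset (Fin n) :=
  Finset.univ.filter fun i => ∀ j, j < i → a - stdVec i + stdVec j ∉ P.bases

open Classical in
/-- The set of externally active indices of `a`: those `i` such that `a + eᵢ - eⱼ ∉ P` for all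
`j < i`. -/
noncomputable def externallyActive (a : Fin n → ℤ) : Finset (Fin n) :=
  Finset.univ.filter fun i => ∀ j, j < i → a + stdVec i - stdVec j ∉ P.bases

/-- The interior polynomial `I_P(x) = ∑_{a ∈ P} x ^ (n - |Int(a)|)`. -/
noncomputable def interiorPoly : Polynomial ℤ :=
  ∑ a ∈ P.bases_finite.toFinset, Polynomial.X ^ (n - (P.internallyActive a).card)

/-- The exterior polynomial `X_P(y) = ∑_{a ∈ P} y ^ (n - |Ext(a)|)`. -/
noncomputable def exteriorPoly : Polynomial ℤ :=
  ∑ a ∈ P.bases_finite.toFinset, Polynomial.X ^ (n - (P.externallyActive a).card)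

/-- `r_k(P) = min {n - |F| : F ⊆ [n], f(F) ≤ f([n]) - k}`, with value `⊤` (infinity) if there is
no such `F`. -/
noncomputable def r (k : ℕ) : ℕ∞ :=
  ⨅ (F : Finset (Fin n)) (_ : P.rank F + k ≤ P.rank Finset.univ), ((n - F.card : ℕ) : ℕ∞)

/-- `r'_k(P) = min {|F| : F ⊆ [n], ∑_{i ∈ F} f({i}) - f(F) ≥ k}`, with value `⊤` (infinity) if
there is no such `F`. -/
noncomputable def r' (k : ℕ) : ℕ∞ :=
  ⨅ (F : Finset (Fin n)) (_ : P.rank F + k ≤ ∑ i ∈ F, P.rank {i}), (F.card : ℕ∞)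

end Polymatroid

/-- The sequence `a 0, a 1, …, a (m - 1)` of the first `m` terms of `a` (all the terms of `a` if
`m = ⊤`) is unimodal: for some `k` it weakly increases up to the index `k` and weakly decreases
from the index `k` on. -/
def IsUnimodalBelow (m : ℕ∞) (a : ℕ → ℤ) : Prop :=
  ∃ k : ℕ, ∀ i : ℕ, ((i + 1 : ℕ) : ℕ∞) < m →
    (i < k → a i ≤ a (i + 1)) ∧ (k ≤ i → a (i + 1) ≤ a i)

namespace Polymatroid

open Polynomial

variable {n : ℕ} (P : Polymatroid n)

/-! ### Tight sets and the exchange property -/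

/-! Read `X` as a success probability and draw the coordinates of `d` as independent geometric
variables truncated at `M`. A spanning `d` lies above exactly one basis `a` from which it differs
only at externally active indices (`IsSpanning.exists_basis`, `basis_unique`), and the cone of such
`d` has probability `(1 - X) ^ f([n]) * X ^ (n - |Ext(a)|)`. So `(1 - X) ^ f([n]) * X_P` is the
probability of spanning.

Modulo `X ^ (k + 1)` only vectors with at most `k` entries below `M` matter. For `k < r_2`, such a
vector fails to span exactly when it vanishes on a cocircuit, and that cocircuit is unique. Hence
the low coefficients of the product are those of 1 minus the numbers of cocircuits by size:
nonnegative at 0, nonpositive afterwards. Dividing by `1 - X` takes partial sums, which keeps a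
"nonnegative, then nonpositive" pattern; the last division turns it into unimodality. Part (ii)
follows by duality. -/

theorem tight_union_inter {a : Fin n → ℤ} (ha : ∀ I : Finset (Fin n), ∑ i ∈ I, a i ≤ (P.rank I : ℤ))
    {S T : Finset (Fin n)} (hS : ∑ i ∈ S, a i = P.rank S) (hT : ∑ i ∈ T, a i = P.rank T) :
    ∑ i ∈ S ∪ T, a i = P.rank (S ∪ T) ∧ ∑ i ∈ S ∩ T, a i = P.rank (S ∩ T) := by
  have h1 := ha (S ∪ T)
  have h2 := ha (S ∩ T)
  have h3 := P.rank_submodular S T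
  have h4 := Finset.sum_union_inter (s₁ := S) (s₂ := T) (f := a)
  zify at h3
  constructor <;> linarith

theorem sum_add_stdVec_sub_stdVec (a : Fin n → ℤ) (i j : Fin n) (I : Finset (Fin n)) :
    ∑ k ∈ I, (a + stdVec i - stdVec j) k =
      ∑ k ∈ I, a k + (if i ∈ I then 1 else 0) - (if j ∈ I then 1 else 0) := by
  simp [stdVec, Finset.sum_add_distrib, Finset.sum_sub_distrib, Pi.single_apply]

/-- A failing exchange is witnessed by a tight set. -/
theorem exists_tight_of_notMem {a : Fin n → ℤ} (ha : a ∈ P.bases) {i j : Fin n} (hj : 0 < a j)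
    (h : a + stdVec i - stdVec j ∉ P.bases) :
    ∃ T : Finset (Fin n), ∑ k ∈ T, a k = P.rank T ∧ i ∈ T ∧ j ∉ T := by
  by_contra! hT
  refine h ⟨fun k => ?_, fun I => ?_, ?_⟩
  · have := ha.1 k
    by_cases hk : k = j
    · subst hk
      simp only [stdVec, Pi.add_apply, Pi.sub_apply, Pi.single_apply]
      split_ifs <;> simp <;> omega
    · simp only [stdVec, Pi.add_apply, Pi.sub_apply, Pi.single_apply, hk, if_false]
      split_ifs <;> omega
  · rw [sum_add_stdVec_sub_stdVec]
    have h1 := ha.2.1 I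
    have h2 := hT I
    by_cases hi : i ∈ I <;> by_cases hjI : j ∈ I <;> simp only [hi, hjI, if_true, if_false]
    · omega
    · have : ∑ k ∈ I, a k ≠ P.rank I := fun h => hjI (h2 h hi)
      omega
    · omega
    · omega
  · rw [sum_add_stdVec_sub_stdVec, ha.2.2]
    simp

/-- If every such exchange failed, intersecting the blocking tight sets would give a tight `T ∋ i`
with `a ≤ b` on `T`, strictly at `i`, so `b` would violate the bound on `T`. -/
theorem exists_exchange {a b : Fin n → ℤ} (ha : a ∈ P.bases) (hb : b ∈ P.bases) {i : Fin n}
    (hi : a i < b i) : ∃ j, b j < a j ∧ a + stdVec i - stdVec j ∈ P.bases := by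
  by_contra! h
  have key : ∀ J : Finset (Fin n), (∀ j ∈ J, b j < a j) →
      ∃ T : Finset (Fin n), ∑ k ∈ T, a k = P.rank T ∧ i ∈ T ∧ ∀ j ∈ J, j ∉ T := by
    intro J
    induction J using Finset.induction_on with
    | empty => exact fun _ => ⟨Finset.univ, ha.2.2, Finset.mem_univ _, by simp⟩
    | insert j J _ ih =>
      intro hJ
      obtain ⟨T, hT, hiT, hJT⟩ := ih fun k hk => hJ k (Finset.mem_insert_of_mem hk)
      have hj := hJ j (Finset.mem_insert_self _ _)
      obtain ⟨S, hS, hiS, hjS⟩ :=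
        P.exists_tight_of_notMem ha ((hb.1 j).trans_lt hj) (h j hj)
      refine ⟨S ∩ T, (P.tight_union_inter ha.2.1 hS hT).2, by simp [hiS, hiT], fun k hk => ?_⟩
      rcases Finset.mem_insert.1 hk with rfl | hk
      · simp [hjS]
      · simp [hJT k hk]
  obtain ⟨T, hT, hiT, hJT⟩ := key (Finset.univ.filter fun j => b j < a j) (by simp)
  have : ∑ k ∈ T, a k < ∑ k ∈ T, b k :=
    Finset.sum_lt_sum (fun k hk => not_lt.1 fun hlt => hJT k (by simpa using hlt) hk) ⟨i, hiT, hi⟩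
  have := hb.2.1 T
  omega

/-! ### Spanning vectors -/

/-- A vector is spanning if it dominates a basis. -/
def IsSpanning (d : Fin n → ℕ) : Prop := ∃ a ∈ P.bases, ∀ i, a i ≤ d i

theorem IsSpanning.rank_univ_le {P : Polymatroid n} {d : Fin n → ℕ} (h : P.IsSpanning d)
    (F : Finset (Fin n)) : P.rank Finset.univ ≤ ∑ i ∈ F, d i + P.rank Fᶜ := by
  obtain ⟨a, ha, had⟩ := h
  have h1 := ha.2.1 Fᶜ
  have h2 := Finset.sum_add_sum_compl F a
  have h3 : ∑ i ∈ F, a i ≤ ∑ i ∈ F, (d i : ℤ) := Finset.sum_le_sum fun i _ => had i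
  have h4 := ha.2.2
  zify
  linarith

/-- An independent `a ≤ d` of maximal sum has every unsaturated index in a tight set. The union `T`
of these is tight and `a = d` off `T`, so the hypothesis at `Tᶜ` makes `a` a basis. -/
theorem isSpanning_of_rank_univ_le {d : Fin n → ℕ}
    (h : ∀ F : Finset (Fin n), P.rank Finset.univ ≤ ∑ i ∈ F, d i + P.rank Fᶜ) :
    P.IsSpanning d := by
  let A : Set (Fin n → ℤ) := {a | (∀ i, 0 ≤ a i) ∧ (∀ i, a i ≤ d i) ∧
    ∀ I : Finset (Fin n), ∑ i ∈ I, a i ≤ (P.rank I : ℤ)}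
  have hA : A.Finite := (Set.finite_Icc (0 : Fin n → ℤ) (fun i => (d i : ℤ))).subset
    fun a ha => ⟨fun i => ha.1 i, fun i => ha.2.1 i⟩
  obtain ⟨a, ha, hmax⟩ := Set.exists_max_image A (fun a => ∑ i, a i) hA
    ⟨0, by simp [A]⟩
  have tight : ∀ i, a i < d i → ∃ T : Finset (Fin n), ∑ k ∈ T, a k = P.rank T ∧ i ∈ T := by
    intro i hi
    by_contra! hT
    have hsum : ∀ I : Finset (Fin n), ∑ k ∈ I, (a + stdVec i) k =
        ∑ k ∈ I, a k + if i ∈ I then 1 else 0 := fun I => by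
      simp [stdVec, Finset.sum_add_distrib, Pi.single_apply]
    have hmem : a + stdVec i ∈ A := by
      refine ⟨fun k => ?_, fun k => ?_, fun I => ?_⟩
      · have := ha.1 k
        simp only [stdVec, Pi.add_apply, Pi.single_apply]
        split_ifs <;> omega
      · have := ha.2.1 k
        by_cases hk : k = i
        · subst hk
          simp only [stdVec, Pi.add_apply, Pi.single_eq_same]
          omega
        · simpa [stdVec, hk] using this
      · rw [hsum]
        have h1 := ha.2.2 I
        have h2 := hT I
        split_ifs with hI
        · have : ∑ k ∈ I, a k ≠ P.rank I := fun h => h2 h hI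
          omega
        · omega
    have h1 := hmax _ hmem
    simp only [hsum, Finset.mem_univ, if_true] at h1
    omega
  have key : ∀ J : Finset (Fin n), (∀ j ∈ J, a j < d j) →
      ∃ T : Finset (Fin n), ∑ k ∈ T, a k = P.rank T ∧ J ⊆ T := by
    intro J
    induction J using Finset.induction_on with
    | empty => exact fun _ => ⟨∅, by simp [P.rank_empty], by simp⟩
    | insert j J _ ih =>
      intro hJ
      obtain ⟨T, hT, hJT⟩ := ih fun k hk => hJ k (Finset.mem_insert_of_mem hk)
      obtain ⟨S, hS, hjS⟩ := tight j (hJ j (Finset.mem_insert_self _ _))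
      refine ⟨S ∪ T, (P.tight_union_inter ha.2.2 hS hT).1, Finset.insert_subset (by simp [hjS]) ?_⟩
      exact hJT.trans Finset.subset_union_right
  obtain ⟨T, hT, hJT⟩ := key (Finset.univ.filter fun j => a j < d j) (by simp)
  have h1 : ∑ i ∈ Tᶜ, a i = ∑ i ∈ Tᶜ, (d i : ℤ) := Finset.sum_congr rfl fun i hi => by
    refine le_antisymm (ha.2.1 i) (not_lt.1 fun hlt => ?_)
    exact (Finset.mem_compl.1 hi) (hJT (by simpa using hlt))
  have h2 := h Tᶜ
  rw [compl_compl] at h2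
  have h3 := Finset.sum_add_sum_compl T a
  have h4 := ha.2.2 Finset.univ
  zify at h2
  exact ⟨a, ⟨ha.1, ha.2.2, by linarith⟩, ha.2.1⟩

/-- A spanning vector dominates a basis from which it differs only at externally active
indices. -/
theorem IsSpanning.exists_basis {P : Polymatroid n} {d : Fin n → ℕ} (h : P.IsSpanning d) :
    ∃ a ∈ P.bases, ∀ i, a i ≤ d i ∧ (i ∉ P.externallyActive a → a i = d i) := by
  -- Moving a unit from `j` to some `i > j` raises this weighted sum by `i - j`, so at a maximum no
  -- inactive index can be unsaturated.
  obtain ⟨a, ⟨ha, had⟩, hmax⟩ := Set.exists_max_image {a | a ∈ P.bases ∧ ∀ i, a i ≤ d i}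
    (fun a => ∑ i : Fin n, (i : ℤ) * a i) (P.bases_finite.subset fun a h => h.1) h
  refine ⟨a, ha, fun i => ⟨had i, fun hi => le_antisymm (had i) (not_lt.1 fun hlt => ?_)⟩⟩
  simp only [externallyActive, Finset.mem_filter, Finset.mem_univ, true_and, not_forall,
    not_not] at hi
  obtain ⟨j, hji, hmem⟩ := hi
  have h1 := hmax _ ⟨hmem, fun k => by
    have := had k
    simp only [stdVec, Pi.add_apply, Pi.sub_apply, Pi.single_apply]
    split_ifs <;> subst_vars <;> omega⟩
  have h2 : ∑ k : Fin n, (k : ℤ) * (a + stdVec i - stdVec j) k =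
      ∑ k : Fin n, (k : ℤ) * a k + i - j := by
    simp [stdVec, mul_add, mul_sub, Finset.sum_add_distrib, Finset.sum_sub_distrib,
      Pi.single_apply]
  rw [h2] at h1
  have : (j : ℕ) < i := hji
  omega

/-- At the largest index where the bases differ, exchange must draw from a smaller index. The
smaller entry is thus inactive, hence equal to `d i`, yet below the other entry. -/
theorem basis_unique {d : Fin n → ℤ} {a b : Fin n → ℤ} (ha : a ∈ P.bases) (hb : b ∈ P.bases)
    (had : ∀ i, a i ≤ d i ∧ (i ∉ P.externallyActive a → a i = d i))
    (hbd : ∀ i, b i ≤ d i ∧ (i ∉ P.externallyActive b → b i = d i)) : a = b := by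
  by_contra hne
  have hne' : (Finset.univ.filter fun i => a i ≠ b i).Nonempty := by
    obtain ⟨i, hi⟩ := Function.ne_iff.1 hne
    exact ⟨i, by simpa using hi⟩
  obtain ⟨i, hi, hmax⟩ := Finset.exists_max_image _ id hne'
  have hi : a i ≠ b i := by simpa using hi
  have aux : ∀ {a b : Fin n → ℤ}, a ∈ P.bases → b ∈ P.bases →
      (∀ i, a i ≤ d i ∧ (i ∉ P.externallyActive a → a i = d i)) → (∀ i, b i ≤ d i) →
      a i < b i → (∀ j, a j ≠ b j → j ≤ i) → False := by
    intro a b ha hb had hbd hlt hmax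
    obtain ⟨j, hj, hmem⟩ := P.exists_exchange ha hb hlt
    have hji : j < i := lt_of_le_of_ne (hmax j hj.ne') fun h => by subst h; omega
    have := (had i).2 fun hact => by
      simp only [externallyActive, Finset.mem_filter] at hact
      exact hact.2 j hji hmem
    have := hbd i
    omega
  rcases lt_or_gt_of_ne hi with hlt | hlt
  · exact aux ha hb had (fun i => (hbd i).1) hlt fun j hj => hmax j (by simpa using hj)
  · exact aux hb ha hbd (fun i => (had i).1) hlt fun j hj => hmax j (by simpa using hj.symm)

/-! ### Truncated geometric weights -/

/-- The weight of the value `v` of a geometric variable truncated at `M`. -/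
noncomputable def geomWeight (M v : ℕ) : ℤ[X] := if v < M then (1 - X) ^ v * X else (1 - X) ^ v

/-- This is the tail probability of a geometric variable; truncation puts all remaining mass at `M`.
-/
theorem sum_geomWeight {M a : ℕ} (h : a ≤ M) :
    ∑ v ∈ Finset.Icc a M, geomWeight M v = (1 - X) ^ a := by
  induction h using Nat.decreasingInduction with
  | self => simp [geomWeight]
  | of_succ a h ih =>
    rw [← Finset.add_sum_Ioc_eq_sum_Icc (by omega), ← Finset.Icc_succ_left_eq_Ioc,
      Nat.succ_eq_succ, Nat.succ_eq_add_one, ih, geomWeight, if_pos (by omega)]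
    ring

/-- The box of vectors with entries at most `M`. -/
def box (n M : ℕ) : Finset (Fin n → ℕ) := Fintype.piFinset fun _ => Finset.Icc 0 M

/-- The product of the geometric weights of the entries. -/
noncomputable def boxWeight (M : ℕ) (d : Fin n → ℕ) : ℤ[X] := ∏ i, geomWeight M (d i)

theorem sum_boxWeight (M : ℕ) : ∑ d ∈ box n M, boxWeight M d = 1 := by
  simp only [box, boxWeight]
  rw [← Finset.prod_univ_sum, Finset.prod_congr rfl fun i _ => sum_geomWeight (Nat.zero_le M)]
  simp

theorem sum_boxWeight_vanishing {M : ℕ} (hM : 0 < M) (C : Finset (Fin n)) :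
    ∑ d ∈ (box n M).filter (fun d => ∀ i ∈ C, d i = 0), boxWeight M d = X ^ C.card := by
  have h : (box n M).filter (fun d => ∀ i ∈ C, d i = 0) =
      Fintype.piFinset fun i => if i ∈ C then {0} else Finset.Icc 0 M := by
    ext d
    simp only [box, Finset.mem_filter, Fintype.mem_piFinset]
    constructor
    · intro h i
      split_ifs with hi
      · simp [h.2 i hi]
      · exact h.1 i
    · intro h
      refine ⟨fun i => ?_, fun i hi => by simpa [hi] using h i⟩
      have := h i
      split_ifs at this with hi
      · simp_all
      · exact this
  have h2 : ∀ i : Fin n, ∑ v ∈ (if i ∈ C then {0} else Finset.Icc 0 M), geomWeight M v =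
      if i ∈ C then X else 1 := by
    intro i
    split_ifs
    · simp [geomWeight, hM]
    · rw [sum_geomWeight (Nat.zero_le M), pow_zero]
  simp only [boxWeight]
  rw [h, ← Finset.prod_univ_sum, Finset.prod_congr rfl fun i _ => h2 i]
  simp

theorem X_pow_dvd_boxWeight {M k : ℕ} {d : Fin n → ℕ} {S : Finset (Fin n)} (hS : k ≤ S.card)
    (h : ∀ i ∈ S, d i < M) : X ^ k ∣ boxWeight M d := by
  refine (pow_dvd_pow X hS).trans ?_
  rw [boxWeight, ← Finset.prod_mul_prod_compl S, ← Finset.prod_const]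
  refine Dvd.dvd.mul_right (Finset.prod_dvd_prod_of_dvd _ _ fun i hi => ?_) _
  rw [geomWeight, if_pos (h i hi)]
  exact Dvd.intro_left _ rfl

/-- The vectors of the box which differ from `a` only by increasing externally active
indices. -/
noncomputable def activeCone (M : ℕ) (a : Fin n → ℤ) : Finset (Fin n → ℕ) :=
  Fintype.piFinset fun i => if i ∈ P.externallyActive a then Finset.Icc (a i).toNat M
    else {(a i).toNat}

theorem basis_le_rank_univ {a : Fin n → ℤ} (ha : a ∈ P.bases) (i : Fin n) :
    a i ≤ P.rank Finset.univ := by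
  rw [← ha.2.2]
  exact Finset.single_le_sum (fun i _ => ha.1 i) (Finset.mem_univ i)

theorem mem_activeCone {M : ℕ} (hM : P.rank Finset.univ < M) {a : Fin n → ℤ} (ha : a ∈ P.bases)
    {d : Fin n → ℕ} : d ∈ P.activeCone M a ↔
      d ∈ box n M ∧ ∀ i, a i ≤ d i ∧ (i ∉ P.externallyActive a → a i = d i) := by
  simp only [activeCone, box, Fintype.mem_piFinset, ← forall_and]
  refine forall_congr' fun i => ?_
  have h1 := ha.1 i
  have h2 := P.basis_le_rank_univ ha i
  split_ifs with hi
  · simp only [Finset.mem_Icc, hi, not_true_eq_false, false_imp_iff, and_true]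
    omega
  · simp only [Finset.mem_Icc, Finset.mem_singleton, hi, not_false_eq_true, true_imp_iff]
    omega

theorem sum_activeCone {M : ℕ} (hM : P.rank Finset.univ < M) {a : Fin n → ℤ} (ha : a ∈ P.bases) :
    ∑ d ∈ P.activeCone M a, boxWeight M d =
      (1 - X) ^ P.rank Finset.univ * X ^ (n - (P.externallyActive a).card) := by
  have h : ∀ i : Fin n, ∑ v ∈ (if i ∈ P.externallyActive a then Finset.Icc (a i).toNat M
      else {(a i).toNat}), geomWeight M v =
      (1 - X) ^ (a i).toNat * if i ∈ P.externallyActive a then 1 else X := by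
    intro i
    have h2 := P.basis_le_rank_univ ha i
    split_ifs
    · rw [sum_geomWeight (by omega), mul_one]
    · rw [Finset.sum_singleton, geomWeight, if_pos (by omega)]
  have h3 : ∑ i, (a i).toNat = P.rank Finset.univ := by
    have := ha.2.2
    zify
    rw [← this]
    exact Finset.sum_congr rfl fun i _ => Int.toNat_of_nonneg (ha.1 i)
  simp only [boxWeight, activeCone]
  rw [← Finset.prod_univ_sum, Finset.prod_congr rfl fun i _ => h i, Finset.prod_mul_distrib,
    Finset.prod_pow_eq_pow_sum, h3, Finset.prod_ite]
  simp [Finset.filter_not, Finset.card_sdiff]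

open Classical in
theorem one_sub_X_pow_mul_exteriorPoly {M : ℕ} (hM : P.rank Finset.univ < M) :
    (1 - X) ^ P.rank Finset.univ * P.exteriorPoly =
      ∑ d ∈ (box n M).filter P.IsSpanning, boxWeight M d := by
  have h : (box n M).filter P.IsSpanning = P.bases_finite.toFinset.biUnion (P.activeCone M) := by
    ext d
    simp only [Finset.mem_filter, Finset.mem_biUnion, Set.Finite.mem_toFinset]
    constructor
    · rintro ⟨hd, hs⟩
      obtain ⟨a, ha, had⟩ := hs.exists_basis
      exact ⟨a, ha, (P.mem_activeCone hM ha).2 ⟨hd, had⟩⟩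
    · rintro ⟨a, ha, had⟩
      rw [P.mem_activeCone hM ha] at had
      exact ⟨had.1, a, ha, fun i => (had.2 i).1⟩
  rw [h, Finset.sum_biUnion, exteriorPoly, Finset.mul_sum]
  · exact Finset.sum_congr rfl fun a ha => (P.sum_activeCone hM (by simpa using ha)).symm
  · intro a ha b hb hab
    simp only [Finset.mem_coe, Set.Finite.mem_toFinset] at ha hb
    refine Finset.disjoint_left.2 fun d hda hdb => hab ?_
    exact P.basis_unique (d := fun i => (d i : ℤ)) ha hb ((P.mem_activeCone hM ha).1 hda).2
      ((P.mem_activeCone hM hb).1 hdb).2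

/-! ### Low coefficients -/

/-- Minimal sets whose complement does not have full rank. -/
def IsCocircuit (C : Finset (Fin n)) : Prop :=
  Minimal (fun F : Finset (Fin n) => P.rank Fᶜ < P.rank Finset.univ) C

open Classical in
/-- The cocircuits of size at most `k` on which `d` vanishes. -/
noncomputable def vanishingCocircuits (k : ℕ) (d : Fin n → ℕ) : Finset (Finset (Fin n)) :=
  Finset.univ.filter fun C => (P.IsCocircuit C ∧ C.card ≤ k) ∧ ∀ i ∈ C, d i = 0

theorem IsCocircuit.not_isSpanning {P : Polymatroid n} {C : Finset (Fin n)} (hC : P.IsCocircuit C)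
    {d : Fin n → ℕ} (hd : ∀ i ∈ C, d i = 0) : ¬ P.IsSpanning d := fun h => by
  have h1 := h.rank_univ_le C
  rw [Finset.sum_eq_zero hd, zero_add] at h1
  exact absurd hC.1 (by omega)

/-- By minimality the complement of `C ∩ D` has full rank, so submodularity on `Cᶜ`, `Dᶜ` adds up
the two rank drops. -/
theorem IsCocircuit.rank_compl_union {P : Polymatroid n} {C D : Finset (Fin n)}
    (hC : P.IsCocircuit C) (hD : P.IsCocircuit D) (hne : C ≠ D) :
    P.rank (C ∪ D)ᶜ + 2 ≤ P.rank Finset.univ := by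
  have h1 : ¬ P.rank (C ∩ D)ᶜ < P.rank Finset.univ := fun h => hne <|
    ((hC.2 h Finset.inter_subset_left).trans Finset.inter_subset_right).antisymm
      ((hD.2 h Finset.inter_subset_right).trans Finset.inter_subset_left)
  have h2 := P.rank_submodular Cᶜ Dᶜ
  rw [← Finset.compl_inter, ← Finset.compl_union] at h2
  have h3 : P.rank Cᶜ < P.rank Finset.univ := hC.1
  have h4 : P.rank Dᶜ < P.rank Finset.univ := hD.1
  omega

theorem card_vanishingCocircuits {k M : ℕ} (hM : P.rank Finset.univ < M)
    (hk : ∀ F : Finset (Fin n), P.rank Fᶜ + 2 ≤ P.rank Finset.univ → k < F.card)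
    {d : Fin n → ℕ} (hd : (Finset.univ.filter fun i => d i < M).card ≤ k)
    (hs : ¬ P.IsSpanning d) : (P.vanishingCocircuits k d).card = 1 := by
  classical
  obtain ⟨F, hF⟩ : ∃ F : Finset (Fin n), ∑ i ∈ F, d i + P.rank Fᶜ < P.rank Finset.univ := by
    by_contra! h
    exact hs (P.isSpanning_of_rank_univ_le h)
  have hFd : F ⊆ Finset.univ.filter fun i => d i < M := fun i hi => by
    have := Finset.single_le_sum (f := d) (fun i _ => Nat.zero_le _) hi
    simp only [Finset.mem_filter, Finset.mem_univ, true_and]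
    omega
  have hFk := (Finset.card_le_card hFd).trans hd
  have h1 : ¬ P.rank Fᶜ + 2 ≤ P.rank Finset.univ := fun h => (hk F h).not_ge hFk
  -- The rank drops by at most 1 off `F`, leaving no room for a positive entry.
  have h0 : ∑ i ∈ F, d i = 0 := by omega
  rw [Finset.sum_eq_zero_iff] at h0
  obtain ⟨C, hCF, hC⟩ := exists_minimal_le_of_wellFoundedLT
    (fun F : Finset (Fin n) => P.rank Fᶜ < P.rank Finset.univ) F (by omega)
  rw [Finset.card_eq_one]
  refine ⟨C, Finset.eq_singleton_iff_unique_mem.2 ⟨?_, fun D hD => ?_⟩⟩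
  · simp only [vanishingCocircuits, Finset.mem_filter, Finset.mem_univ, true_and]
    exact ⟨⟨hC, (Finset.card_le_card hCF).trans hFk⟩, fun i hi => h0 i (hCF hi)⟩
  · simp only [vanishingCocircuits, Finset.mem_filter, Finset.mem_univ, true_and] at hD
    by_contra hne
    -- Two distinct cocircuits would have a union of more than `k` elements, all among the at most
    -- `k` entries below `M`.
    have h2 := hk _ (hD.1.1.rank_compl_union hC hne)
    refine (h2.trans_le (Finset.card_le_card ?_)).not_ge hd
    refine Finset.union_subset (fun i hi => ?_) (hCF.trans hFd)
    simp only [Finset.mem_filter, Finset.mem_univ, true_and, hD.2 i hi]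
    omega

open Classical in
/-- The low coefficients count cocircuits. -/
theorem coeff_one_sub_X_pow_mul_exteriorPoly {k : ℕ}
    (hk : ∀ F : Finset (Fin n), P.rank Fᶜ + 2 ≤ P.rank Finset.univ → k < F.card) :
    ((1 - X) ^ P.rank Finset.univ * P.exteriorPoly).coeff k = (if k = 0 then 1 else 0) -
      ((Finset.univ.filter fun C => P.IsCocircuit C ∧ C.card = k).card : ℤ) := by
  set M := P.rank Finset.univ + 1
  have hM : P.rank Finset.univ < M := by omega
  have h1 : ∑ C ∈ Finset.univ.filter (fun C => P.IsCocircuit C ∧ C.card ≤ k), (X : ℤ[X]) ^ C.card =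
      ∑ d ∈ box n M, ((P.vanishingCocircuits k d).card : ℤ[X]) * boxWeight M d := by
    rw [Finset.sum_congr rfl fun C _ => (sum_boxWeight_vanishing (by omega : 0 < M) C).symm]
    simp only [Finset.sum_filter (s := box n M)]
    rw [Finset.sum_comm]
    refine Finset.sum_congr rfl fun d _ => ?_
    rw [← Finset.sum_filter, Finset.sum_const, nsmul_eq_mul, Finset.filter_filter,
      vanishingCocircuits]
  have h2 : (1 - X) ^ P.rank Finset.univ * P.exteriorPoly = 1 -
      ∑ d ∈ box n M, (if P.IsSpanning d then 0 else 1) * boxWeight M d := by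
    rw [P.one_sub_X_pow_mul_exteriorPoly hM, eq_sub_iff_add_eq, Finset.sum_filter,
      ← Finset.sum_add_distrib]
    refine (Finset.sum_congr rfl fun d _ => ?_).trans (sum_boxWeight M)
    split_ifs <;> simp
  have h3 : (X : ℤ[X]) ^ (k + 1) ∣
      ∑ d ∈ box n M, ((P.vanishingCocircuits k d).card : ℤ[X]) * boxWeight M d -
      ∑ d ∈ box n M, (if P.IsSpanning d then 0 else 1) * boxWeight M d := by
    rw [← Finset.sum_sub_distrib]
    refine Finset.dvd_sum fun d _ => ?_
    rw [← sub_mul]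
    by_cases hd : (Finset.univ.filter fun i => d i < M).card ≤ k
    · by_cases hs : P.IsSpanning d
      · have : P.vanishingCocircuits k d = ∅ := Finset.filter_eq_empty_iff.2 fun C _ hC =>
          hC.1.1.not_isSpanning hC.2 hs
        simp [hs, this]
      · simp [hs, P.card_vanishingCocircuits hM hk hd hs]
    · exact Dvd.dvd.mul_left (X_pow_dvd_boxWeight (S := Finset.univ.filter fun i => d i < M)
        (by omega) (by simp)) _
  rw [← h1, X_pow_dvd_iff] at h3
  have h4 := h3 k (by omega)
  rw [coeff_sub, sub_eq_zero] at h4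
  rw [h2, coeff_sub, ← h4, coeff_one, finsetSum_coeff]
  congr 2
  · simp only [coeff_X_pow]
    rw [← Finset.sum_filter, Finset.filter_filter, Finset.sum_const, nsmul_eq_mul, mul_one]
    congr 2
    ext C
    simp only [Finset.mem_filter, Finset.mem_univ, true_and]
    constructor
    · rintro ⟨⟨h, -⟩, h'⟩
      exact ⟨h, h'.symm⟩
    · rintro ⟨h, h'⟩
      exact ⟨⟨h, h'.le⟩, h'.symm⟩

/-! ### Sign patterns and unimodality -/

/-- Below `m`, the sequence is first nonnegative and then nonpositive. -/
def SignPattern (m : ℕ∞) (g : ℕ → ℤ) : Prop :=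
  ∃ k : ℕ, ∀ i : ℕ, (i : ℕ∞) < m → (i < k → 0 ≤ g i) ∧ (k ≤ i → g i ≤ 0)

theorem coeff_one_sub_X_mul_succ (p : ℤ[X]) (i : ℕ) :
    ((1 - X) * p).coeff (i + 1) = p.coeff (i + 1) - p.coeff i := by
  rw [sub_mul, one_mul, coeff_sub, coeff_X_mul]

theorem coeff_one_sub_X_mul_zero (p : ℤ[X]) : ((1 - X) * p).coeff 0 = p.coeff 0 := by
  simp [sub_mul]

theorem isUnimodalBelow_of_signPattern {m : ℕ∞} {p : ℤ[X]}
    (h : SignPattern m ((1 - X) * p).coeff) : IsUnimodalBelow m fun i => p.coeff i := by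
  obtain ⟨k, hk⟩ := h
  refine ⟨k - 1, fun i hi => ?_⟩
  have := hk (i + 1) hi
  rw [coeff_one_sub_X_mul_succ] at this
  exact ⟨fun h => by linarith [this.1 (by omega)], fun h => by linarith [this.2 (by omega)]⟩

theorem SignPattern.of_one_sub_X_mul {m : ℕ∞} {p : ℤ[X]}
    (h : SignPattern m ((1 - X) * p).coeff) : SignPattern m p.coeff := by
  obtain ⟨k, hk⟩ := h
  have lt_of_le : ∀ {i j : ℕ}, i ≤ j → (j : ℕ∞) < m → (i : ℕ∞) < m := fun hij hj =>
    lt_of_le_of_lt (by exact_mod_cast hij) hj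
  have up : ∀ i : ℕ, i < k → (i : ℕ∞) < m → 0 ≤ p.coeff i := by
    intro i
    induction i with
    | zero =>
      intro h0 hm
      have := (hk 0 hm).1 h0
      rwa [coeff_one_sub_X_mul_zero] at this
    | succ i ih =>
      intro hi hm
      have h1 := (hk (i + 1) hm).1 hi
      rw [coeff_one_sub_X_mul_succ] at h1
      linarith [ih (by omega) (lt_of_le (by omega) hm)]
  have down : ∀ i j : ℕ, i ≤ j → k ≤ i → (j : ℕ∞) < m → p.coeff j ≤ p.coeff i := by
    intro i j hij hi
    induction j, hij using Nat.le_induction with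
    | base => exact fun _ => le_rfl
    | succ j hij ih =>
      intro hm
      have h1 := (hk (j + 1) hm).2 (by omega)
      rw [coeff_one_sub_X_mul_succ] at h1
      linarith [ih (lt_of_le (by omega) hm)]
  -- Coefficients beyond the degree vanish, so the sign change occurs at a finite index even when `m
  -- = ⊤`.
  have hex : ∃ l, k ≤ l ∧ p.coeff l ≤ 0 :=
    ⟨max k (p.natDegree + 1), le_max_left _ _, (coeff_eq_zero_of_natDegree_lt (by omega)).le⟩
  classical
  refine ⟨Nat.find hex, fun i hi => ⟨fun hlt => ?_, fun hle => ?_⟩⟩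
  · by_cases hik : i < k
    · exact up i hik hi
    · have := Nat.find_min hex hlt
      push Not at this
      exact (this (by omega)).le
  · exact (down _ i hle (Nat.find_spec hex).1 hi).trans (Nat.find_spec hex).2

theorem SignPattern.of_one_sub_X_pow_mul {m : ℕ∞} {p : ℤ[X]} (k : ℕ)
    (h : SignPattern m ((1 - X) ^ k * p).coeff) : SignPattern m p.coeff := by
  induction k with
  | zero => simpa using h
  | succ k ih =>
    rw [pow_succ', mul_assoc] at h
    exact ih h.of_one_sub_X_mul

theorem signPattern_of_nonpos {m : ℕ∞} {g : ℕ → ℤ} (h0 : 0 < m → 0 ≤ g 0)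
    (h : ∀ i : ℕ, i ≠ 0 → (i : ℕ∞) < m → g i ≤ 0) : SignPattern m g :=
  ⟨1, fun i hi => ⟨fun h1 => by
    obtain rfl : i = 0 := by omega
    exact h0 (by simpa using hi), fun h1 => h i (by omega) hi⟩⟩

theorem lt_card_of_lt_r {k : ℕ} (h : (k : ℕ∞) < P.r 2) {F : Finset (Fin n)}
    (hF : P.rank Fᶜ + 2 ≤ P.rank Finset.univ) : k < F.card := by
  have h1 : P.r 2 ≤ ((n - (Fᶜ).card : ℕ) : ℕ∞) := iInf₂_le (Fᶜ) hF
  have h2 := h.trans_le h1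
  rw [Nat.cast_lt, Finset.card_compl, Fintype.card_fin] at h2
  omega

theorem isUnimodalBelow_exteriorPoly :
    IsUnimodalBelow (P.r 2) fun i => P.exteriorPoly.coeff i := by
  classical
  have hcoeff := fun (k : ℕ) (hk : (k : ℕ∞) < P.r 2) =>
    P.coeff_one_sub_X_pow_mul_exteriorPoly (k := k) fun F hF => P.lt_card_of_lt_r hk hF
  have hempty : ¬ P.IsCocircuit ∅ := fun h => by simpa using h.1
  apply isUnimodalBelow_of_signPattern
  rcases Nat.eq_zero_or_pos (P.rank Finset.univ) with h0 | hpos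
  -- In rank 0 there is no factor `1 - X` to spare for unimodality. A rank drop of 2 is impossible,
  -- so the coefficient formula holds for every `k`.
  · have hX : P.exteriorPoly = 1 := by
      ext k
      have := P.coeff_one_sub_X_pow_mul_exteriorPoly (k := k) fun F hF => by omega
      rw [h0, pow_zero, one_mul] at this
      rw [this, coeff_one, Finset.filter_eq_empty_iff.2]
      · simp
      · rintro C - ⟨hC, -⟩
        have : P.rank Cᶜ < P.rank Finset.univ := hC.1
        omega
    rw [hX, mul_one]
    refine signPattern_of_nonpos (fun _ => by simp) fun i hi _ => ?_
    rw [coeff_sub, coeff_one, if_neg hi, coeff_X]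
    split_ifs <;> simp
  · obtain ⟨s, hs⟩ := Nat.exists_eq_succ_of_ne_zero hpos.ne'
    -- Only `f([n]) - 1` factors are removed; the remaining one encodes consecutive differences.
    apply SignPattern.of_one_sub_X_pow_mul s
    rw [← mul_assoc, ← pow_succ, ← Nat.succ_eq_add_one, ← hs]
    refine signPattern_of_nonpos (fun h => ?_) fun i hi him => ?_
    · rw [hcoeff 0 (by simpa using h), if_pos rfl, Finset.filter_eq_empty_iff.2]
      · simp
      · rintro C - ⟨hC, hC0⟩
        rw [Finset.card_eq_zero] at hC0
        exact hempty (hC0 ▸ hC)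
    · rw [hcoeff i him, if_neg hi]
      simp

/-! ### Duality -/

theorem rank_union_le (I J : Finset (Fin n)) : P.rank (I ∪ J) ≤ P.rank I + P.rank J :=
  (Nat.le_add_right _ _).trans (P.rank_submodular I J)

theorem rank_le_sum (I : Finset (Fin n)) : P.rank I ≤ ∑ i ∈ I, P.rank {i} := by
  induction I using Finset.induction_on with
  | empty => simp [P.rank_empty]
  | insert i I hi ih =>
    rw [Finset.sum_insert hi, Finset.insert_eq]
    exact (P.rank_union_le _ _).trans (by omega)

theorem rank_univ_le_sum_add (I : Finset (Fin n)) :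
    P.rank Finset.univ ≤ ∑ i ∈ I, P.rank {i} + P.rank Iᶜ := by
  have h1 := P.rank_union_le I Iᶜ
  rw [Finset.union_compl] at h1
  have := P.rank_le_sum I
  omega

/-- The dual polymatroid, whose bases are the differences `c - a` for bases `a`, where
`c i = f {i}`. -/
def dual : Polymatroid n where
  -- The natural subtraction never truncates, by `rank_univ_le_sum_add`.
  rank I := ∑ i ∈ I, P.rank {i} + P.rank Iᶜ - P.rank Finset.univ
  rank_empty := by simp
  rank_mono I J h := by
    have h1 : Iᶜ = Jᶜ ∪ (J \ I) := by
      ext x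
      have := @h x
      simp only [Finset.mem_compl, Finset.mem_union, Finset.mem_sdiff]
      tauto
    have h2 := P.rank_union_le Jᶜ (J \ I)
    rw [← h1] at h2
    have h3 := P.rank_le_sum (J \ I)
    have h4 := Finset.sum_sdiff (f := fun i => P.rank {i}) h
    omega
  rank_submodular I J := by
    have h1 := P.rank_submodular Iᶜ Jᶜ
    rw [← Finset.compl_inter, ← Finset.compl_union] at h1
    have h2 := Finset.sum_union_inter (s₁ := I) (s₂ := J) (f := fun i => P.rank {i})
    have h3 := P.rank_univ_le_sum_add I
    have h4 := P.rank_univ_le_sum_add J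
    have h5 := P.rank_univ_le_sum_add (I ∩ J)
    have h6 := P.rank_univ_le_sum_add (I ∪ J)
    omega

theorem dual_rank (I : Finset (Fin n)) : (P.dual.rank I : ℤ) =
    ∑ i ∈ I, (P.rank {i} : ℤ) + P.rank Iᶜ - P.rank Finset.univ := by
  have := P.rank_univ_le_sum_add I
  simp only [dual]
  push_cast [Nat.cast_sub this]
  rfl

/-- The vector of the ranks of singletons. -/
def singletonRank : Fin n → ℤ := fun i => P.rank {i}

/-- Given the total sum, the dual bound on `I` is the original bound on `Iᶜ`. -/
theorem sub_mem_dual_bases {a : Fin n → ℤ} :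
    P.singletonRank - a ∈ P.dual.bases ↔ a ∈ P.bases := by
  have hsum : ∀ I : Finset (Fin n), ∑ i ∈ I, (P.singletonRank - a) i =
      ∑ i ∈ I, (P.rank {i} : ℤ) - ∑ i ∈ I, a i := fun I => by
    simp [singletonRank, Finset.sum_sub_distrib]
  constructor
  · rintro ⟨-, h1, h2⟩
    rw [hsum, dual_rank] at h2
    simp only [Finset.compl_univ, P.rank_empty, Nat.cast_zero] at h2
    refine ⟨fun i => ?_, fun I => ?_, by linarith⟩
    · have h3 := h1 {i}
      rw [hsum, dual_rank, Finset.sum_singleton, Finset.sum_singleton] at h3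
      have h4 := P.rank_mono {i}ᶜ Finset.univ (Finset.subset_univ _)
      omega
    · have h3 := h1 Iᶜ
      rw [hsum, dual_rank, compl_compl] at h3
      have h4 := Finset.sum_add_sum_compl I a
      linarith
  · rintro ⟨h0, h1, h2⟩
    refine ⟨fun i => ?_, fun I => ?_, ?_⟩
    · have := h1 {i}
      rw [Finset.sum_singleton] at this
      simpa [singletonRank] using this
    · rw [hsum, dual_rank]
      have h3 := h1 Iᶜ
      have h4 := Finset.sum_add_sum_compl I a
      linarith
    · rw [hsum, dual_rank, Finset.compl_univ, P.rank_empty, h2]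
      simp

theorem dual_externallyActive (a : Fin n → ℤ) :
    P.dual.externallyActive (P.singletonRank - a) = P.internallyActive a := by
  have h : ∀ i j, P.singletonRank - a + stdVec i - stdVec j =
      P.singletonRank - (a - stdVec i + stdVec j) := fun i j => by abel
  ext i
  simp only [externallyActive, internallyActive, h, sub_mem_dual_bases, Finset.mem_filter]

theorem dual_exteriorPoly : P.dual.exteriorPoly = P.interiorPoly := by
  refine (Finset.sum_equiv (Equiv.subLeft P.singletonRank) (fun a => ?_) fun a _ => ?_).symm
  · simp [sub_mem_dual_bases]
  · simp [dual_externallyActive]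

theorem r'_le_dual_r (k : ℕ) : P.r' k ≤ P.dual.r k := by
  refine le_iInf₂ fun F hF => ?_
  have h : P.rank Fᶜ + k ≤ ∑ i ∈ Fᶜ, P.rank {i} := by
    have h1 := Finset.sum_add_sum_compl F fun i => (P.rank {i} : ℤ)
    zify at hF ⊢
    rw [dual_rank, dual_rank, Finset.compl_univ, P.rank_empty] at hF
    push_cast at hF
    linarith
  refine (iInf₂_le Fᶜ h).trans ?_
  rw [Finset.card_compl, Fintype.card_fin]

end Polymatroid

theorem IsUnimodalBelow.mono {m m' : ℕ∞} (h : m ≤ m') {a : ℕ → ℤ} (ha : IsUnimodalBelow m' a) :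
    IsUnimodalBelow m a := by
  obtain ⟨k, hk⟩ := ha
  exact ⟨k, fun i hi => hk i (hi.trans_le h)⟩

theorem theorem4p2 {n : ℕ} (P : Polymatroid n) :
    IsUnimodalBelow (P.r 2) (fun i => P.exteriorPoly.coeff i) ∧
      IsUnimodalBelow (P.r' 2) (fun i => P.interiorPoly.coeff i) := by
  refine ⟨P.isUnimodalBelow_exteriorPoly, ?_⟩
  rw [← P.dual_exteriorPoly]
  exact P.dual.isUnimodalBelow_exteriorPoly.mono (P.r'_le_dual_r 2)
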